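/- Let $p\ge 1$ be an integer, $f:\mathbb{R}\to\mathbb{R}$, and $x^*\in\mathbb{R}$ fixed. For $h>0$ put $f_n=f(nh)$, $n\in\mathbb{Z}$. Let $B_p$ be the centered cardinal B-spline of degree $p$, with knots $-\frac{p+1}{2},-\frac{p+1}{2}+1,\dots,\frac{p+1}{2}$ (normalized so that $\sum_{n\in\mathbb{Z}}B_p(\cdot-n)=1$), and let $$\mathcal{J}(x^*)=\{n\in\mathbb{Z}:B_p(x^*/h-n)>0\},\qquad C^p_k(x^*)=B_p(x^*/h-k),\qquad L_p(f_{k,p})=\sum_{j=-\lfloor p/2\rfloor}^{\lfloor p/2\rfloor}c_{p,j}\,f_{k+j},$$ with $$c_{p,j}=\sum_{l=0}^{\lceil\frac{p+1}{2}\rceil-1}\frac{t(2l+p+1,p+1)}{\binom{2l+p+1}{p+1}}\sum_{i=0}^{2l}\frac{(-1)^i}{i!\,(2l-i)!}\,\delta_{\,l-i+\lceil\frac{p+1}{2}\rceil,\;j+1+\lfloor\frac p2\rfloor},$$ where $\delta$ is the Kronecker delta and $t(i,j)$ are the central factorial numbers of the first kind: $t(0,0)=t(1,1)=1$, $t(0,1)=t(1,0)=0$;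 $t(i,0)=0$ and $t(i,1)=\prod_{l=1}^{i-1}(\frac i2-l)$ for $i\ge2$; $t(i,j)=0$ for $j>i$; $t(i,i)=1$; and $t(i,j)=t(i-2,j-2)-\left(\frac{i-2}{2}\right)^2t(i-2,j)$ for $2\le j<i$. The smoothness indicators are $$I_{k,p}=\Big(\sum_{j=-\lfloor p/2\rfloor}^{\lfloor p/2\rfloor}(-1)^{j+1}\binom{m}{j+\lfloor p/2\rfloor}f_{k+j}\Big)^2,\qquad m=\begin{cases}p,&p\text{ even},\\p-1,&p\text{ odd}.\end{cases}$$ Let $\Psi=\Psi_h$ be a real-valued function on $\mathbb{R}$, which may depend on $h$, and define $$\alpha^p_k(x^*)=C^p_k(x^*)\,\Psi(I_{k,p}),\qquad \omega^p_k(x^*)=\frac{\alpha^p_k(x^*)}{\sum_{j\in\mathcal{J}(x^*)}\alpha^p_j(x^*)},\qquad Q^{NL}_p(f)(x^*)=\sum_{k\in\mathcal{J}(x^*)}\omega^p_k(x^*)\,L_p(f_{k,p}).$$ Suppose that, for all sufficiently small $h>0$: 1. $\Psi(I_{k,p})=\Psi(I_{l,p})(1+K_{k,l}h^{p+1})$ for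 all $k,l\in\mathcal{J}(x^*)$, where the real numbers $K_{k,l}$ are bounded in absolute value by a constant independent of $h$; 2. $\sum_{j\in\mathcal{J}(x^*)}\alpha^p_j(x^*)\ne0$, so that the weights $\omega^p_k(x^*)$ are well defined; 3. $f$ is of class $C^{p+1}$ on the interval $[h(k-\lfloor p/2\rfloor),h(k+\lfloor p/2\rfloor)]$ for every $k\in\mathcal{J}(x^*)$; and, if $p=1$ (when these intervals are single points), $f$ is of class $C^{2}$ on $[h\min\mathcal{J}(x^*),h\max\mathcal{J}(x^*)]$. Then $$|Q^{NL}_p(f)(x^*)-f(x^*)|=O(h^{p+1})\qquad\text{as }h\to0^+.$$ -/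

import Mathlib

open Filter Topology

noncomputable section

namespace WenoBSpline

/-- The centered cardinal B-spline `B_p` of degree `p`, with the equidistant knots
`-(p+1)/2, -(p+1)/2 + 1, …, (p+1)/2`, by the Cox–de Boor recursion. -/
def bspline : ℕ → ℝ → ℝ
  | 0, x => if -(1 / 2) ≤ x ∧ x < 1 / 2 then 1 else 0
  | p + 1, x =>
      ((x + ((p : ℝ) + 2) / 2) * bspline p (x + 1 / 2)
        + (((p : ℝ) + 2) / 2 - x) * bspline p (x - 1 / 2)) / ((p : ℝ) + 1)

theorem bspline_eq_zero (p : ℕ) : ∀ x : ℝ, ((p : ℝ) + 1) / 2 < |x| → bspline p x = 0 := by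
  induction p with
  | zero =>
    intro x hx
    simp only [bspline]
    rw [if_neg]
    rintro ⟨h1, h2⟩
    have : |x| ≤ 1 / 2 := abs_le.mpr ⟨h1, h2.le⟩
    norm_num at hx
    linarith
  | succ p ih =>
    intro x hx
    push_cast at hx
    have h1 : ((p : ℝ) + 1) / 2 < |x + 1 / 2| := by
      have := abs_sub_abs_le_abs_sub x (-(1 / 2))
      rw [abs_neg, abs_of_pos (by norm_num : (0 : ℝ) < 1 / 2), sub_neg_eq_add] at this
      linarith
    have h2 : ((p : ℝ) + 1) / 2 < |x - 1 / 2| := by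
      have := abs_sub_abs_le_abs_sub x (1 / 2)
      rw [abs_of_pos (by norm_num : (0 : ℝ) < 1 / 2)] at this
      linarith
    simp only [bspline, ih _ h1, ih _ h2, mul_zero, add_zero, zero_div]

theorem finite_active (p : ℕ) (h x : ℝ) :
    {n : ℤ | 0 < bspline p (x / h - n)}.Finite := by
  refine (Set.finite_Icc ⌊x / h - ((p : ℝ) + 1) / 2⌋ ⌈x / h + ((p : ℝ) + 1) / 2⌉).subset ?_
  intro n hn
  have hle : |x / h - n| ≤ ((p : ℝ) + 1) / 2 := by
    by_contra hc
    have := bspline_eq_zero p _ (not_le.mp hc)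
    have hn' : 0 < bspline p (x / h - n) := hn
    exact hn'.ne' this
  obtain ⟨h1, h2⟩ := abs_le.mp hle
  constructor
  · exact_mod_cast (Int.floor_le _).trans (by linarith : x / h - ((p : ℝ) + 1) / 2 ≤ n)
  · exact_mod_cast (by linarith : (n : ℝ) ≤ x / h + ((p : ℝ) + 1) / 2).trans (Int.le_ceil _)

/-- `𝒥(x) = {n ∈ ℤ : B_p(x/h - n) > 0}`. -/
def active (p : ℕ) (h x : ℝ) : Finset ℤ := (finite_active p h x).toFinset

/-- The central factorial numbers of the first kind `t(i, j)`. -/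
def centralFactorial : ℕ → ℕ → ℝ
  | 0, 0 => 1
  | 0, _ + 1 => 0
  | 1, 0 => 0
  | 1, 1 => 1
  | 1, _ + 2 => 0
  | _ + 2, 0 => 0
  | i + 2, 1 => ∏ l ∈ Finset.Icc 1 (i + 1), (((i : ℝ) + 2) / 2 - l)
  | i + 2, j + 2 =>
      if i < j then 0
      else if j = i then 1
      else centralFactorial i j - ((i : ℝ) / 2) ^ 2 * centralFactorial i (j + 2)

/-- The coefficients `c_{p,j}`. Natural number division gives `p / 2 = ⌊p/2⌋` and
`(p + 2) / 2 = ⌈(p+1)/2⌉`. -/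
def coeff (p : ℕ) (j : ℤ) : ℝ :=
  ∑ l ∈ Finset.range ((p + 2) / 2),
    centralFactorial (2 * l + p + 1) (p + 1) / (Nat.choose (2 * l + p + 1) (p + 1) : ℝ) *
      ∑ i ∈ Finset.range (2 * l + 1),
        (-1 : ℝ) ^ i / ((Nat.factorial i : ℝ) * (Nat.factorial (2 * l - i) : ℝ)) *
          (if (l : ℤ) - (i : ℤ) + (((p + 2) / 2 : ℕ) : ℤ) = j + 1 + ((p / 2 : ℕ) : ℤ)
            then 1 else 0)

/-- `L_p(f_{n,p}) = ∑_{j=-⌊p/2⌋}^{⌊p/2⌋} c_{p,j} f((n+j)h)`. -/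
def localFunctional (p : ℕ) (h : ℝ) (f : ℝ → ℝ) (n : ℤ) : ℝ :=
  ∑ j ∈ Finset.Icc (-((p / 2 : ℕ) : ℤ)) ((p / 2 : ℕ) : ℤ),
    coeff p j * f (((n : ℝ) + (j : ℝ)) * h)

/-- The smoothness indicator `I_{k,p}(f)`: the square of the centered finite difference of `f`
of order `p` (for even `p`) or `p - 1` (for odd `p`) at the nodes `(k+j)h`, `|j| ≤ ⌊p/2⌋`. -/
def smoothnessIndicator (p : ℕ) (h : ℝ) (f : ℝ → ℝ) (k : ℤ) : ℝ :=
  (∑ j ∈ Finset.Icc (-((p / 2 : ℕ) : ℤ)) ((p / 2 : ℕ) : ℤ),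
    (-1 : ℝ) ^ (j + 1) *
      (Nat.choose (if Even p then p else p - 1) (j + ((p / 2 : ℕ) : ℤ)).toNat : ℝ) *
      f (((k : ℝ) + (j : ℝ)) * h)) ^ 2

/-- `α_k^p(x) = C_k^p(x) Ψ(I_{k,p})`, where `C_k^p(x) = B_p(x/h - k)`. -/
def alpha (p : ℕ) (h : ℝ) (f : ℝ → ℝ) (Ψ : ℝ → ℝ) (x : ℝ) (k : ℤ) : ℝ :=
  bspline p (x / h - k) * Ψ (smoothnessIndicator p h f k)

/-- The non-linear weight `ω_k^p(x) = α_k^p(x) / ∑_{j ∈ 𝒥(x)} α_j^p(x)`. -/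
def omega (p : ℕ) (h : ℝ) (f : ℝ → ℝ) (Ψ : ℝ → ℝ) (x : ℝ) (k : ℤ) : ℝ :=
  alpha p h f Ψ x k / ∑ j ∈ active p h x, alpha p h f Ψ x j

/-- The non-linear WENO B-spline quasi-interpolant
`Q_p^{NL}(f)(x) = ∑_{k ∈ 𝒥(x)} ω_k^p(x) L_p(f_{k,p})`. -/
def quasiInterpolantNL (p : ℕ) (h : ℝ) (f : ℝ → ℝ) (Ψ : ℝ → ℝ) (x : ℝ) : ℝ :=
  ∑ k ∈ active p h x, omega p h f Ψ x k * localFunctional p h f k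

end WenoBSpline

end

/-!
On the active nodes, the non-linear weights differ from the B-spline weights `B_p (x / h - k)` by a
relative `O(h^{p+1})` (`abs_weighted_mean_sub_le`), so the non-linear quasi-interpolant has the
order of the linear one, `∑ k, B_p (x / h - k) L_p (f_{k,p})`. The order of the latter is the Taylor
expansion of `f` at `x` (`exists_taylor_bound_stencil`) together with reproduction of polynomials of
degree at most `p` (`sum_active_moment`).

Reproduction rests on two facts about the Marsden polynomial `∏_{i=1}^{p} (u + (p + 1) / 2 - i)`.
Marsden's identity (`tsum_bspline_mul_marsden`), proved along the Cox–de Boor recursion, says that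
the B-spline series whose coefficients are the values of that polynomial at `k - t` is the function
`y ↦ (y - t) ^ p`. On the other side, `L_p` maps the monomial `u ^ p` to the Marsden polynomial
(`sum_coeff_mul_pow_eq_marsden`). Hence the linear quasi-interpolant reproduces all translates of
the monomial of degree `p`, and these span the polynomials of degree at most `p`.

The statement about `L_p` is proved with formal power series in the symbol `X` of `d/du`. The
central difference has symbol `s = 2 sinh (X / 2)`. The expansion of `X ^ k / k!` in powers of `s`
has the central factorial numbers as coefficients (`sum_centralFactorial_coeff`), and therefore the
symbol of `L_p` agrees with `(X / s) ^ (p + 1)` modulo `X ^ (p + 1)`. A second order differential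
equation for the powers of `X / s` identifies their coefficients with central factorial numbers once
more (`centralFactorial_eq_coeff`), now as the coefficients of the Marsden polynomial.
-/

noncomputable section

namespace WenoBSpline

/-! ### Central factorial numbers -/

theorem centralFactorial_zero_right (n : ℕ) (hn : n ≠ 0) : centralFactorial n 0 = 0 := by
  match n with
  | 0 => exact absurd rfl hn
  | 1 => simp [centralFactorial]
  | n + 2 => simp [centralFactorial]

theorem centralFactorial_of_lt (n k : ℕ) (h : n < k) : centralFactorial n k = 0 := by
  match n, k with
  | 0, k + 1 => simp [centralFactorial]
  | 1, k + 2 => simp [centralFactorial]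
  | n + 2, k + 2 => simp [centralFactorial, show n < k by omega]

theorem centralFactorial_self (n : ℕ) : centralFactorial n n = 1 := by
  match n with
  | 0 => simp [centralFactorial]
  | 1 => simp [centralFactorial]
  | n + 2 => simp [centralFactorial]

/-- The defining recursion of the central factorial numbers, without its restriction on the
indices. -/
theorem centralFactorial_add_two (n k : ℕ) :
    centralFactorial (n + 2) (k + 2) =
      centralFactorial n k - ((n : ℝ) / 2) ^ 2 * centralFactorial n (k + 2) := by
  rcases lt_trichotomy n k with h | h | h
  · rw [centralFactorial_of_lt _ _ (by omega : n + 2 < k + 2), centralFactorial_of_lt _ _ h,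
      centralFactorial_of_lt _ _ (by omega : n < k + 2)]
    ring
  · subst h
    rw [centralFactorial_self, centralFactorial_self,
      centralFactorial_of_lt _ _ (by omega : n < n + 2)]
    ring
  · simp [centralFactorial, h.not_gt, h.ne]

theorem centralFactorial_add_two_zero (n : ℕ) :
    centralFactorial (n + 2) 0 = -((n : ℝ) / 2) ^ 2 * centralFactorial n 0 := by
  rcases Nat.eq_zero_or_pos n with rfl | h
  · simp [centralFactorial]
  · rw [centralFactorial_zero_right _ (by omega), centralFactorial_zero_right _ (by omega)]
    ring

theorem centralFactorial_add_two_one (n : ℕ) :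
    centralFactorial (n + 2) 1 = -((n : ℝ) / 2) ^ 2 * centralFactorial n 1 := by
  match n with
  | 0 => simp [centralFactorial]
  | 1 => norm_num [centralFactorial, Finset.prod_Icc_succ_top]
  | n + 2 =>
    simp only [centralFactorial]
    have h1 : ∏ l ∈ Finset.Icc 1 (n + 2 + 1), ((((n + 2 : ℕ) : ℝ) + 2) / 2 - (l : ℝ)) =
        ∏ l ∈ Finset.range (n + 1 + 1 + 1), ((((n + 2 : ℕ) : ℝ) + 2) / 2 - ((l + 1 : ℕ) : ℝ)) := by
      rw [Finset.range_eq_Ico, Finset.prod_Ico_add' (fun l : ℕ =>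
        (((n + 2 : ℕ) : ℝ) + 2) / 2 - (l : ℝ)) 0 (n + 1 + 1 + 1) 1]
      rfl
    have h2 : ∏ l ∈ Finset.Icc 1 (n + 1), (((n : ℝ) + 2) / 2 - (l : ℝ)) =
        ∏ l ∈ Finset.range (n + 1), (((n : ℝ) + 2) / 2 - ((l + 1 : ℕ) : ℝ)) := by
      rw [Finset.range_eq_Ico, Finset.prod_Ico_add' (fun l : ℕ =>
        ((n : ℝ) + 2) / 2 - (l : ℝ)) 0 (n + 1) 1]
      rfl
    rw [h1, h2, Finset.prod_range_succ, Finset.prod_range_succ']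
    have h3 : ∀ l ∈ Finset.range (n + 1), (((n + 2 : ℕ) : ℝ) + 2) / 2 - ((l + 1 + 1 : ℕ) : ℝ) =
        ((n : ℝ) + 2) / 2 - ((l + 1 : ℕ) : ℝ) := by
      intro l _
      push_cast
      ring
    rw [Finset.prod_congr rfl h3]
    push_cast
    ring

theorem centralFactorial_odd (n k : ℕ) (h : Odd (n + k)) : centralFactorial n k = 0 := by
  induction n using Nat.twoStepInduction generalizing k with
  | zero =>
    match k with
    | 0 => simp at h
    | k + 1 => simp [centralFactorial]
  | one =>
    match k with
    | 0 => simp [centralFactorial]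
    | 1 => exact absurd h (by decide)
    | k + 2 => simp [centralFactorial]
  | more n ih _ =>
    match k with
    | 0 => rw [centralFactorial_add_two_zero, ih 0 (by grind)]; simp
    | 1 => rw [centralFactorial_add_two_one, ih 1 (by grind)]; simp
    | k + 2 =>
      rw [centralFactorial_add_two, ih k (by grind), ih (k + 2) (by grind)]
      simp

/-! ### The symbol of the central difference -/

open PowerSeries in
theorem coeff_rescale_exp (a : ℝ) (n : ℕ) :
    PowerSeries.coeff n (rescale a (exp ℝ)) = a ^ n / (n.factorial : ℝ) := by
  rw [coeff_rescale, coeff_exp]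
  simp [div_eq_mul_inv]

open PowerSeries in
theorem derivative_rescale_exp (a : ℝ) :
    derivative ℝ (rescale a (exp ℝ)) = C a * rescale a (exp ℝ) := by
  ext n
  rw [coeff_derivative, coeff_C_mul, coeff_rescale_exp, coeff_rescale_exp, Nat.factorial_succ]
  have : (n.factorial : ℝ) ≠ 0 := by positivity
  have : (n : ℝ) + 1 ≠ 0 := by positivity
  push_cast
  field_simp
  ring

/-- The power series `2 sinh (X / 2) = exp (X / 2) - exp (-X / 2)`. With `X` read as the operator
`d/du`, it is the central difference operator `g ↦ g (u + 1/2) - g (u - 1/2)`. -/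
def diffSymbol : PowerSeries ℝ :=
  PowerSeries.rescale (1 / 2 : ℝ) (PowerSeries.exp ℝ) -
    PowerSeries.rescale (-(1 / 2) : ℝ) (PowerSeries.exp ℝ)

/-- The power series `cosh (X / 2)`, the derivative of `diffSymbol`. -/
def meanSymbol : PowerSeries ℝ :=
  PowerSeries.C (1 / 2 : ℝ) * (PowerSeries.rescale (1 / 2 : ℝ) (PowerSeries.exp ℝ) +
    PowerSeries.rescale (-(1 / 2) : ℝ) (PowerSeries.exp ℝ))

open PowerSeries in
theorem derivative_diffSymbol : derivative ℝ diffSymbol = meanSymbol := by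
  rw [diffSymbol, meanSymbol, map_sub, derivative_rescale_exp, derivative_rescale_exp, map_neg]
  ring

open PowerSeries in
theorem derivative_meanSymbol : derivative ℝ meanSymbol = C (1 / 4 : ℝ) * diffSymbol := by
  have h : (C (1 / 4 : ℝ) : ℝ⟦X⟧) = C (1 / 2) * C (1 / 2) := by rw [← map_mul]; norm_num
  rw [diffSymbol, meanSymbol, Derivation.leibniz, map_add, derivative_rescale_exp,
    derivative_rescale_exp, derivative_C, map_neg, h]
  simp only [smul_eq_mul]
  ring

open PowerSeries in
theorem meanSymbol_sq : meanSymbol ^ 2 = 1 + C (1 / 4 : ℝ) * diffSymbol ^ 2 := by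
  have h : (C (1 / 4 : ℝ) : ℝ⟦X⟧) = C (1 / 2) * C (1 / 2) := by rw [← map_mul]; norm_num
  have h4 : (C (1 / 2 : ℝ) : ℝ⟦X⟧) * C (1 / 2) * 4 = 1 := by
    rw [← h, show (4 : ℝ⟦X⟧) = C 4 from (map_ofNat C 4).symm, ← map_mul]
    norm_num
  have h1 : rescale (1 / 2 : ℝ) (exp ℝ) * rescale (-(1 / 2) : ℝ) (exp ℝ) = 1 := by
    rw [exp_mul_exp_eq_exp_add]
    ext n
    rw [coeff_rescale_exp, coeff_one]
    cases n <;> simp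
  rw [diffSymbol, meanSymbol, h]
  linear_combination (4 * C (1 / 2 : ℝ) * C (1 / 2 : ℝ)) * h1 + h4

open PowerSeries in
theorem constantCoeff_diffSymbol : constantCoeff diffSymbol = 0 := by
  rw [← coeff_zero_eq_constantCoeff_apply, diffSymbol, map_sub, coeff_rescale_exp,
    coeff_rescale_exp]
  simp

open PowerSeries in
theorem coeff_one_diffSymbol : PowerSeries.coeff 1 diffSymbol = 1 := by
  rw [diffSymbol, map_sub, coeff_rescale_exp, coeff_rescale_exp]
  norm_num

/-- The power series `2 sinh (X / 2) / X`. -/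
def diffQuotient : PowerSeries ℝ := PowerSeries.mk fun n => PowerSeries.coeff (n + 1) diffSymbol

open PowerSeries in
theorem diffSymbol_eq : diffSymbol = X * diffQuotient := by
  ext n
  cases n with
  | zero => simp [constantCoeff_diffSymbol]
  | succ n => rw [coeff_succ_X_mul, diffQuotient, coeff_mk]

open PowerSeries in
theorem constantCoeff_diffQuotient : constantCoeff diffQuotient = 1 := by
  rw [← coeff_zero_eq_constantCoeff_apply, diffQuotient, coeff_mk, coeff_one_diffSymbol]

open PowerSeries in
theorem coeff_diffSymbol_pow_of_lt (N n : ℕ) (h : N < n) :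
    PowerSeries.coeff N (diffSymbol ^ n) = 0 := by
  rw [diffSymbol_eq, mul_pow, coeff_X_pow_mul', if_neg (by omega)]

open PowerSeries in
theorem coeff_diffSymbol_pow_add_two (N n : ℕ) :
    ((N : ℝ) + 1) * (N + 2) * PowerSeries.coeff (N + 2) (diffSymbol ^ (n + 2)) =
      ((n : ℝ) + 2) * (n + 1) * PowerSeries.coeff N (diffSymbol ^ n) +
        ((n : ℝ) + 2) ^ 2 / 4 * PowerSeries.coeff N (diffSymbol ^ (n + 2)) := by
  have h : derivative ℝ (derivative ℝ (diffSymbol ^ (n + 2))) =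
      C (((n : ℝ) + 2) * (n + 1)) * diffSymbol ^ n +
        C (((n : ℝ) + 2) ^ 2 / 4) * diffSymbol ^ (n + 2) := by
    rw [derivative_pow, derivative_diffSymbol, Derivation.leibniz, Derivation.leibniz,
      derivative_meanSymbol, show n + 2 - 1 = n + 1 from rfl, derivative_pow,
      derivative_diffSymbol, show n + 1 - 1 = n from rfl, Derivation.map_natCast]
    have h4 : (C (((n : ℝ) + 2) ^ 2 / 4) : ℝ⟦X⟧) = C (1 / 4) * C (((n : ℝ) + 2) ^ 2) := by
      rw [← map_mul]
      congr 1
      ring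
    rw [h4]
    simp only [smul_eq_mul, map_mul, map_add, map_pow, map_natCast, map_one, map_ofNat]
    push_cast
    linear_combination (((n : ℝ⟦X⟧) + 2) * (n + 1) * diffSymbol ^ n) * meanSymbol_sq
  have h2 := congrArg (PowerSeries.coeff N) h
  rw [coeff_derivative, coeff_derivative, map_add, coeff_C_mul, coeff_C_mul] at h2
  push_cast at h2
  linear_combination h2

open PowerSeries in
theorem coeff_diffSymbol_pow_one_add_two (N : ℕ) :
    ((N : ℝ) + 1) * (N + 2) * PowerSeries.coeff (N + 2) diffSymbol =
      1 / 4 * PowerSeries.coeff N diffSymbol := by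
  have h2 := congrArg (PowerSeries.coeff N) (congrArg (derivative ℝ) derivative_diffSymbol)
  rw [derivative_meanSymbol, coeff_derivative, coeff_derivative, coeff_C_mul] at h2
  push_cast at h2
  linear_combination h2

open PowerSeries in
/-- The power series identity `∑ n, t(n, k) s ^ n / n! = X ^ k / k!` for `s = 2 sinh (X / 2)`,
coefficient by coefficient. It holds because the recursion of the central factorial numbers is
transposed to the differential equation `(s ^ n)'' = n (n - 1) s ^ (n - 2) + n ^ 2 / 4 s ^ n`. -/
theorem sum_centralFactorial_coeff (N k M : ℕ) (hM : N < M) :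
    ∑ n ∈ Finset.range M,
      centralFactorial n k / (n.factorial : ℝ) * PowerSeries.coeff N (diffSymbol ^ n) =
      if N = k then 1 / (k.factorial : ℝ) else 0 := by
  induction N using Nat.twoStepInduction generalizing k M with
  | zero =>
    rw [Finset.sum_eq_single 0]
    · cases k <;> simp [centralFactorial]
    · intro n _ hn
      rw [coeff_diffSymbol_pow_of_lt _ _ (by omega), mul_zero]
    · intro h
      simp at h; omega
  | one =>
    rw [Finset.sum_eq_single 1]
    · rcases k with _ | _ | k <;> simp [centralFactorial, coeff_one_diffSymbol]
    · intro n _ hn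
      rcases Nat.eq_zero_or_pos n with rfl | h
      · simp [coeff_one]
      · rw [coeff_diffSymbol_pow_of_lt _ _ (by omega), mul_zero]
    · intro h
      simp at h; omega
  | more N ih _ =>
    obtain ⟨M, rfl⟩ : ∃ M', M = M' + 2 := ⟨M - 2, by omega⟩
    have hN : ((N : ℝ) + 1) * (N + 2) ≠ 0 := by positivity
    -- after multiplication by `(N + 1) (N + 2)`, the coefficient of `s ^ n` recurses on `N`
    have h1 : ((N : ℝ) + 1) * (N + 2) * ∑ n ∈ Finset.range (M + 2),
        centralFactorial n k / (n.factorial : ℝ) * PowerSeries.coeff (N + 2) (diffSymbol ^ n) =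
        ∑ n ∈ Finset.range M, centralFactorial (n + 2) k / (n.factorial : ℝ) *
          PowerSeries.coeff N (diffSymbol ^ n) +
        ∑ n ∈ Finset.range (M + 2), ((n : ℝ) / 2) ^ 2 * (centralFactorial n k /
          (n.factorial : ℝ) * PowerSeries.coeff N (diffSymbol ^ n)) := by
      rw [Finset.sum_range_succ', Finset.sum_range_succ', Finset.sum_range_succ' _ (M + 1),
        Finset.sum_range_succ' _ M, mul_add, mul_add, Finset.mul_sum, ← add_assoc, ← add_assoc,
        ← Finset.sum_add_distrib]
      congr 1
      · congr 1
        · refine Finset.sum_congr rfl fun n _ => ?_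
          have := coeff_diffSymbol_pow_add_two N n
          have hf : (n.factorial : ℝ) ≠ 0 := by positivity
          have hn1 : (n : ℝ) + 1 ≠ 0 := by positivity
          have hn2 : (n : ℝ) + 1 + 1 ≠ 0 := by positivity
          simp only [Nat.factorial_succ, add_assoc, Nat.reduceAdd]
          push_cast
          have e : (n : ℝ) + 2 ≠ 0 := by positivity
          field_simp
          linear_combination (centralFactorial (n + 2) k) * 4 * this
        · have := coeff_diffSymbol_pow_one_add_two N
          simp only [zero_add, pow_one, Nat.factorial_one, Nat.cast_one]
          linear_combination centralFactorial 1 k * this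
      · simp [coeff_one]
    have h2 : ∑ n ∈ Finset.range M, centralFactorial (n + 2) k / (n.factorial : ℝ) *
          PowerSeries.coeff N (diffSymbol ^ n) = ∑ n ∈ Finset.range (M + 2),
          centralFactorial (n + 2) k / (n.factorial : ℝ) *
            PowerSeries.coeff N (diffSymbol ^ n) := by
      rw [Finset.sum_range_succ _ (M + 1), Finset.sum_range_succ _ M,
        coeff_diffSymbol_pow_of_lt _ _ (by omega), coeff_diffSymbol_pow_of_lt _ _ (by omega)]
      simp
    rw [h2, ← Finset.sum_add_distrib] at h1
    refine mul_left_cancel₀ hN (h1.trans ?_)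
    match k with
    | 0 =>
      rw [Finset.sum_eq_zero, if_neg (by omega), mul_zero]
      intro n _
      rw [centralFactorial_add_two_zero]
      ring
    | 1 =>
      rw [Finset.sum_eq_zero, if_neg (by omega), mul_zero]
      intro n _
      rw [centralFactorial_add_two_one]
      ring
    | k + 2 =>
      have h3 := ih k (M + 2) (by omega)
      have h4 : ∀ n ∈ Finset.range (M + 2), centralFactorial (n + 2) (k + 2) / (n.factorial : ℝ) *
          PowerSeries.coeff N (diffSymbol ^ n) + ((n : ℝ) / 2) ^ 2 *
          (centralFactorial n (k + 2) / (n.factorial : ℝ) *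
            PowerSeries.coeff N (diffSymbol ^ n)) =
          centralFactorial n k / (n.factorial : ℝ) * PowerSeries.coeff N (diffSymbol ^ n) := by
        intro n _
        rw [centralFactorial_add_two]
        ring
      rw [Finset.sum_congr rfl h4, h3]
      by_cases hk : N = k
      · subst hk
        have hf : (N.factorial : ℝ) ≠ 0 := by positivity
        have hn1 : (N : ℝ) + 1 ≠ 0 := by positivity
        simp only [if_true, Nat.factorial_succ]
        push_cast
        field_simp
        ring
      · rw [if_neg hk, if_neg (by omega), mul_zero]

open PowerSeries in
/-- With `R = X / (2 sinh (X / 2))` and `m = n + 1`, the operator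
`(X d/dX - m) (X d/dX - (m + 1))` maps `R ^ m` to
`m (m + 1) R ^ (m + 2) + (m / 2) ^ 2 X ^ 2 R ^ m`; here coefficient by coefficient. -/
theorem coeff_inv_pow_recursion (n i : ℕ) :
    ((n : ℝ) + 1) * (n + 2) * PowerSeries.coeff i (diffQuotient⁻¹ ^ (n + 3)) +
      ((n : ℝ) + 1) ^ 2 / 4 *
        (if 2 ≤ i then PowerSeries.coeff (i - 2) (diffQuotient⁻¹ ^ (n + 1)) else 0) =
      ((i : ℝ) - (n + 1)) * (i - (n + 2)) * PowerSeries.coeff i (diffQuotient⁻¹ ^ (n + 1)) := by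
  have hR : diffQuotient * diffQuotient⁻¹ = 1 :=
    PowerSeries.mul_inv_cancel _ (by rw [constantCoeff_diffQuotient]; exact one_ne_zero)
  have hsR : diffSymbol * diffQuotient⁻¹ = X := by rw [diffSymbol_eq, mul_assoc, hR, mul_one]
  set R := diffQuotient⁻¹ with hRdef
  have hdR : X * derivative ℝ R = R - meanSymbol * R ^ 2 := by
    have h := congrArg (derivative ℝ) hsR
    rw [Derivation.leibniz, derivative_diffSymbol, derivative_X] at h
    simp only [smul_eq_mul] at h
    linear_combination R * h - (derivative ℝ R) * hsR
  have hdc : X * derivative ℝ meanSymbol * R = C (1 / 4 : ℝ) * X ^ 2 := by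
    rw [derivative_meanSymbol]
    linear_combination (C (1 / 4 : ℝ) * X) * hsR
  -- the first order factor `X d/dX - (n + 1)` on `R ^ (n + 1)`, and then `X d/dX - (n + 2)`
  have hF : X * derivative ℝ (R ^ (n + 1)) - ((n : ℝ⟦X⟧) + 1) * R ^ (n + 1) =
      -((n : ℝ⟦X⟧) + 1) * (meanSymbol * R ^ (n + 2)) := by
    rw [derivative_pow, Nat.add_sub_cancel]
    push_cast
    linear_combination (((n : ℝ⟦X⟧) + 1) * R ^ n) * hdR
  have hG : X * derivative ℝ (meanSymbol * R ^ (n + 2)) -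
      ((n : ℝ⟦X⟧) + 2) * (meanSymbol * R ^ (n + 2)) =
      -((n : ℝ⟦X⟧) + 2) * R ^ (n + 3) -
        ((n : ℝ⟦X⟧) + 1) * (C (1 / 4 : ℝ) * (X ^ 2 * R ^ (n + 1))) := by
    rw [Derivation.leibniz, derivative_pow, show n + 2 - 1 = n + 1 from rfl]
    simp only [smul_eq_mul]
    push_cast
    linear_combination (((n : ℝ⟦X⟧) + 2) * R ^ (n + 1) * meanSymbol) * hdR + R ^ (n + 1) * hdc -
      (((n : ℝ⟦X⟧) + 2) * R ^ (n + 3)) * meanSymbol_sq -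
      (((n : ℝ⟦X⟧) + 2) * C (1 / 4 : ℝ) * R ^ (n + 1) * (diffSymbol * R + X)) * hsR
  have hX : ∀ (f : ℝ⟦X⟧) (m : ℕ), PowerSeries.coeff m (X * derivative ℝ f) =
      (m : ℝ) * PowerSeries.coeff m f := by
    intro f m
    cases m with
    | zero => simp
    | succ m =>
      rw [coeff_succ_X_mul, coeff_derivative]
      push_cast
      ring
  have hN : ∀ (a : ℝ) (f : ℝ⟦X⟧) (m : ℕ), PowerSeries.coeff m (C a * f) =
      a * PowerSeries.coeff m f := fun a f m => coeff_C_mul m f a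
  have e1 : ((n : ℝ⟦X⟧) + 1) = C ((n : ℝ) + 1) := by simp
  have e2 : ((n : ℝ⟦X⟧) + 2) = C ((n : ℝ) + 2) := by
    rw [map_add, map_natCast, map_ofNat]
  have hF' := congrArg (PowerSeries.coeff i) hF
  have hG' := congrArg (PowerSeries.coeff i) hG
  rw [e1, neg_mul, map_sub, map_neg, hX, hN, hN] at hF'
  rw [e2, e1, neg_mul, map_sub, map_sub, map_neg, hX, hN, hN, hN, hN, coeff_X_pow_mul'] at hG'
  linear_combination -((i : ℝ) - (n + 2)) * hF' + ((n : ℝ) + 1) * hG'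

open PowerSeries in
/-- Lagrange inversion for `s = 2 sinh (X / 2)`: the central factorial numbers, which are the
coefficients in the expansion of `X ^ k / k!` in powers of `s`, are also the coefficients of the
powers of `X / s`. Both families obey the same recursion, by `coeff_inv_pow_recursion`. -/
theorem centralFactorial_eq_coeff (n j : ℕ) :
    centralFactorial (n + 1) (j + 1) * (j.factorial : ℝ) =
      (n.factorial : ℝ) *
        (if j ≤ n then PowerSeries.coeff (n - j) (diffQuotient⁻¹ ^ (n + 1)) else 0) := by
  induction n using Nat.twoStepInduction generalizing j with
  | zero =>
    cases j with
    | zero => simp [centralFactorial, constantCoeff_diffQuotient]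
    | succ j => simp [centralFactorial]
  | one =>
    have hp1 : PowerSeries.coeff 1 diffQuotient = 0 := by
      have h := coeff_diffSymbol_pow_one_add_two 0
      rw [diffSymbol_eq, coeff_succ_X_mul] at h
      simpa using h
    have hR : PowerSeries.coeff 1 diffQuotient⁻¹ = 0 := by
      have h : diffQuotient * diffQuotient⁻¹ = 1 :=
        PowerSeries.mul_inv_cancel _ (by rw [constantCoeff_diffQuotient]; exact one_ne_zero)
      have h1 := congrArg (PowerSeries.coeff 1) h
      rw [coeff_mul] at h1
      simpa [Finset.Nat.antidiagonal_succ, hp1, constantCoeff_diffQuotient, coeff_one] using h1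
    rcases j with _ | _ | j
    · have h0 : PowerSeries.coeff 1 (diffQuotient⁻¹ ^ 2) = 0 := by
        rw [pow_two, coeff_mul]
        simp [Finset.Nat.antidiagonal_succ, hR]
      norm_num [centralFactorial, h0]
    · simp [centralFactorial, constantCoeff_diffQuotient]
    · simp [centralFactorial]
  | more n ih _ =>
    have hf : ((n + 2).factorial : ℝ) = ((n : ℝ) + 1) * (n + 2) * n.factorial := by
      simp only [Nat.factorial_succ]
      push_cast
      ring
    by_cases hj : j ≤ n + 2
    · rw [if_pos hj, hf]
      have hrec := coeff_inv_pow_recursion n (n + 2 - j)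
      have h2 : (n.factorial : ℝ) * (if 2 ≤ n + 2 - j then
          PowerSeries.coeff (n + 2 - j - 2) (diffQuotient⁻¹ ^ (n + 1)) else 0) =
          centralFactorial (n + 1) (j + 1) * (j.factorial : ℝ) := by
        rw [ih j]
        by_cases h : j ≤ n
        · rw [if_pos h, if_pos (by omega), show n + 2 - j - 2 = n - j by omega]
        · rw [if_neg h, if_neg (by omega)]
      obtain ⟨c, hc⟩ : ∃ c, c = if 2 ≤ n + 2 - j then
          PowerSeries.coeff (n + 2 - j - 2) (diffQuotient⁻¹ ^ (n + 1)) else 0 := ⟨_, rfl⟩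
      rw [← hc] at hrec h2
      clear hc
      rw [Nat.cast_sub hj] at hrec
      match j, hj with
      | 0, _ =>
        rw [show n + 2 + 1 = (n + 1) + 2 from rfl, show 0 + 1 = 1 from rfl] at *
        rw [centralFactorial_add_two_one]
        push_cast at hrec ⊢
        linear_combination -(n.factorial : ℝ) * hrec + ((n : ℝ) + 1) ^ 2 / 4 * h2
      | 1, _ =>
        rw [show n + 2 + 1 = (n + 1) + 2 from rfl, show 1 + 1 = 0 + 2 from rfl] at *
        rw [centralFactorial_add_two, centralFactorial_zero_right _ (by omega)]
        push_cast at hrec ⊢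
        linear_combination -(n.factorial : ℝ) * hrec + ((n : ℝ) + 1) ^ 2 / 4 * h2
      | j + 2, hj =>
        have h0 := ih j
        rw [if_pos (by omega)] at h0
        rw [show n + 2 - (j + 2) = n - j by omega] at *
        rw [show n + 2 + 1 = (n + 1) + 2 from rfl, show j + 2 + 1 = (j + 1) + 2 from rfl] at *
        rw [centralFactorial_add_two]
        have hf' : ((j + 2).factorial : ℝ) = ((j : ℝ) + 1) * (j + 2) * j.factorial := by
          simp only [Nat.factorial_succ]
          push_cast
          ring
        rw [hf'] at h2
        rw [hf']
        push_cast at hrec ⊢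
        linear_combination -(n.factorial : ℝ) * hrec + ((n : ℝ) + 1) ^ 2 / 4 * h2 +
          ((j : ℝ) + 1) * (j + 2) * h0
    · rw [if_neg hj, centralFactorial_of_lt _ _ (by omega)]
      simp

/-! ### The local functional on monomials -/

open PowerSeries in
theorem coeff_diffSymbol_pow_mul (k q : ℕ) (u : ℝ) :
    PowerSeries.coeff q (diffSymbol ^ k * rescale u (exp ℝ)) =
      ∑ i ∈ Finset.range (k + 1), (-1 : ℝ) ^ i * (k.choose i : ℝ) *
        ((u + ((k : ℝ) / 2 - i)) ^ q / (q.factorial : ℝ)) := by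
  have hpow : ∀ (a : ℝ) (m : ℕ), rescale a (exp ℝ) ^ m = rescale (m * a) (exp ℝ) := by
    intro a m
    rw [← map_pow, exp_pow_eq_rescale_exp, rescale_rescale]
  rw [diffSymbol, sub_eq_neg_add, add_pow, Finset.sum_mul, map_sum]
  refine Finset.sum_congr rfl fun i hi => ?_
  have hik : i ≤ k := by simpa [Nat.lt_succ_iff] using hi
  rw [neg_pow, hpow, hpow]
  have h : (-1 : ℝ⟦X⟧) ^ i * rescale (i * (-(1 / 2)) : ℝ) (exp ℝ) *
      rescale (((k - i : ℕ) : ℝ) * (1 / 2)) (exp ℝ) * (k.choose i : ℝ⟦X⟧) * rescale u (exp ℝ) =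
      C ((-1 : ℝ) ^ i * (k.choose i : ℝ)) * (rescale u (exp ℝ) * (rescale (i * (-(1 / 2)) : ℝ)
        (exp ℝ) * rescale (((k - i : ℕ) : ℝ) * (1 / 2)) (exp ℝ))) := by
    simp only [map_mul, map_pow, map_neg, map_one, map_natCast]
    ring
  rw [h, exp_mul_exp_eq_exp_add, exp_mul_exp_eq_exp_add, coeff_C_mul, coeff_rescale_exp,
    Nat.cast_sub hik]
  congr 4
  ring

/-- The weight of the central difference of order `i` in the local functional of degree `p`. It is
defined for all `i` and vanishes for odd `i`. -/
def diffWeight (p i : ℕ) : ℝ :=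
  centralFactorial (p + 1 + i) (p + 1) * ((p + 1).factorial : ℝ) / ((p + 1 + i).factorial : ℝ)

/-- The symbol of the local functional of degree `p`, as a polynomial in the central difference. -/
def localSymbol (p : ℕ) : PowerSeries ℝ :=
  ∑ l ∈ Finset.range ((p + 2) / 2), PowerSeries.C (diffWeight p (2 * l)) * diffSymbol ^ (2 * l)

theorem diffWeight_odd (p i : ℕ) (hi : Odd i) : diffWeight p i = 0 := by
  rw [diffWeight, centralFactorial_odd _ _ (by grind)]
  simp

theorem sum_range_eq_sum_even {M : Type*} [AddCommMonoid M] (g : ℕ → M)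
    (hg : ∀ i, Odd i → g i = 0) (p : ℕ) :
    ∑ l ∈ Finset.range ((p + 2) / 2), g (2 * l) = ∑ i ∈ Finset.range (p + 1), g i := by
  induction p using Nat.twoStepInduction with
  | zero => simp
  | one => simp [Finset.sum_range_succ, hg 1 odd_one]
  | more p ih _ =>
    rw [show (p + 2 + 2) / 2 = (p + 2) / 2 + 1 by omega, Finset.sum_range_succ, ih,
      Finset.sum_range_succ _ (p + 2), Finset.sum_range_succ _ (p + 1)]
    rcases Nat.even_or_odd p with h | h
    · rw [hg (p + 1) h.add_one, add_zero, show 2 * ((p + 2) / 2) = p + 2 by grind]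
    · rw [hg (p + 2) (by grind), add_zero, show 2 * ((p + 2) / 2) = p + 1 by grind]

theorem sum_coeff_mul (p : ℕ) (g : ℤ → ℝ) :
    ∑ j ∈ Finset.Icc (-((p / 2 : ℕ) : ℤ)) ((p / 2 : ℕ) : ℤ), coeff p j * g j =
      ∑ l ∈ Finset.range ((p + 2) / 2), diffWeight p (2 * l) *
        ∑ i ∈ Finset.range (2 * l + 1), (-1 : ℝ) ^ i * ((2 * l).choose i : ℝ) *
          g ((l : ℤ) - i) := by
  simp only [coeff, Finset.sum_mul]
  rw [Finset.sum_comm]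
  refine Finset.sum_congr rfl fun l hl => ?_
  have hl' : l ≤ p / 2 := by
    have := Finset.mem_range.mp hl
    omega
  simp only [Finset.mul_sum, Finset.sum_mul]
  rw [Finset.sum_comm]
  refine Finset.sum_congr rfl fun i hi => ?_
  have hi' : i ≤ 2 * l := by simpa [Nat.lt_succ_iff] using hi
  rw [Finset.sum_eq_single ((l : ℤ) - i)]
  · rw [if_pos (by omega), diffWeight, Nat.cast_choose ℝ (by omega : p + 1 ≤ 2 * l + p + 1),
      Nat.cast_choose ℝ hi', show 2 * l + p + 1 - (p + 1) = 2 * l by omega,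
      show p + 1 + 2 * l = 2 * l + p + 1 by omega]
    have h1 : ((2 * l + p + 1).factorial : ℝ) ≠ 0 := by positivity
    have h2 : ((p + 1).factorial : ℝ) ≠ 0 := by positivity
    have h3 : ((2 * l).factorial : ℝ) ≠ 0 := by positivity
    have h4 : (i.factorial : ℝ) ≠ 0 := by positivity
    have h5 : ((2 * l - i).factorial : ℝ) ≠ 0 := by positivity
    field_simp
  · intro j _ hj
    rw [if_neg (by omega)]
    ring
  · intro h
    exact absurd (Finset.mem_Icc.mpr ⟨by omega, by omega⟩) h

open PowerSeries in
theorem sum_coeff_mul_pow (p : ℕ) (u : ℝ) :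
    ∑ j ∈ Finset.Icc (-((p / 2 : ℕ) : ℤ)) ((p / 2 : ℕ) : ℤ), coeff p j * (u + (j : ℝ)) ^ p =
      (p.factorial : ℝ) * PowerSeries.coeff p (localSymbol p * rescale u (exp ℝ)) := by
  have hp : (p.factorial : ℝ) ≠ 0 := by positivity
  rw [sum_coeff_mul p fun j => (u + (j : ℝ)) ^ p, localSymbol, Finset.sum_mul, map_sum,
    Finset.mul_sum]
  refine Finset.sum_congr rfl fun l _ => ?_
  rw [mul_assoc, coeff_C_mul, coeff_diffSymbol_pow_mul, Finset.mul_sum, Finset.mul_sum,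
    Finset.mul_sum]
  refine Finset.sum_congr rfl fun i _ => ?_
  push_cast
  field_simp

open PowerSeries in
/-- Modulo `X ^ (p + 1)`, the symbol of the local functional is the inverse of
`(2 sinh (X / 2) / X) ^ (p + 1)`, the symbol of convolution with the B-spline. -/
theorem X_pow_dvd_localSymbol_mul_sub_one (p : ℕ) :
    (X : ℝ⟦X⟧) ^ (p + 1) ∣ localSymbol p * diffQuotient ^ (p + 1) - 1 := by
  have hL : localSymbol p = ∑ i ∈ Finset.range (p + 1), C (diffWeight p i) * diffSymbol ^ i :=
    sum_range_eq_sum_even (fun i => C (diffWeight p i) * diffSymbol ^ i)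
      (fun i hi => by rw [diffWeight_odd p i hi]; simp) p
  -- after multiplication by `X ^ (p + 1)`, the product is `(p + 1)!` times the truncated expansion
  -- of `X ^ (p + 1) / (p + 1)!` in powers of the central difference
  rw [X_pow_dvd_iff]
  intro m hm
  have hp : ((p + 1).factorial : ℝ) ≠ 0 := by positivity
  have h1 : PowerSeries.coeff (m + (p + 1)) (localSymbol p * diffSymbol ^ (p + 1)) =
      ((p + 1).factorial : ℝ) * ∑ n ∈ Finset.range (p + 1 + (p + 1)),
        centralFactorial n (p + 1) / (n.factorial : ℝ) *
          PowerSeries.coeff (m + (p + 1)) (diffSymbol ^ n) := by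
    rw [Finset.sum_range_add, Finset.sum_eq_zero, zero_add, hL, Finset.sum_mul, map_sum,
      Finset.mul_sum]
    · refine Finset.sum_congr rfl fun i _ => ?_
      rw [mul_assoc, coeff_C_mul, ← pow_add, diffWeight, add_comm i]
      ring
    · intro n hn
      rw [centralFactorial_of_lt _ _ (Finset.mem_range.mp hn)]
      simp
  rw [sum_centralFactorial_coeff _ _ _ (by omega), diffSymbol_eq, mul_pow, mul_left_comm,
    coeff_X_pow_mul, mul_ite, mul_one_div_cancel hp, mul_zero] at h1
  rw [map_sub, h1, coeff_one, sub_eq_zero]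
  congr 1
  simp

/-- The Marsden polynomial `∏_{i=1}^{p} (u + (p + 1) / 2 - i)` of degree `p`. -/
def marsden (p : ℕ) (u : ℝ) : ℝ := ∏ i ∈ Finset.range p, (u + ((p : ℝ) - 1) / 2 - i)

theorem marsden_add_two (p : ℕ) (u : ℝ) :
    marsden (p + 2) u = (u ^ 2 - (((p : ℝ) + 1) / 2) ^ 2) * marsden p u := by
  rw [marsden, Finset.prod_range_succ, Finset.prod_range_succ', marsden]
  have h : ∀ i ∈ Finset.range p, u + (((p + 2 : ℕ) : ℝ) - 1) / 2 - ((i + 1 : ℕ) : ℝ) =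
      u + ((p : ℝ) - 1) / 2 - i := by
    intro i _
    push_cast
    ring
  rw [Finset.prod_congr rfl h]
  push_cast
  ring

theorem sum_centralFactorial_mul_pow (p M : ℕ) (hM : p < M) (u : ℝ) :
    ∑ j ∈ Finset.range M, centralFactorial (p + 1) (j + 1) * u ^ j = marsden p u := by
  induction p using Nat.twoStepInduction generalizing M with
  | zero =>
    rw [Finset.sum_eq_single 0]
    · simp [centralFactorial, marsden]
    · intro j _ hj
      rw [centralFactorial_of_lt _ _ (by omega), zero_mul]
    · simp only [Finset.mem_range]; omega
  | one =>
    rw [Finset.sum_eq_single 1]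
    · simp [centralFactorial, marsden]
    · intro j _ hj
      rcases Nat.eq_zero_or_pos j with rfl | h
      · simp [centralFactorial]
      · rw [centralFactorial_of_lt _ _ (by omega), zero_mul]
    · simp only [Finset.mem_range]; omega
  | more p ih _ =>
    obtain ⟨M, rfl⟩ : ∃ M', M = M' + 2 := ⟨M - 2, by omega⟩
    have h1 := ih M (by omega)
    have h2 := ih (M + 2) (by omega)
    have h : ∀ j ∈ Finset.range M, centralFactorial (p + 2 + 1) (j + 1 + 1 + 1) * u ^ (j + 1 + 1) =
        u ^ 2 * (centralFactorial (p + 1) (j + 1) * u ^ j) - (((p : ℝ) + 1) / 2) ^ 2 *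
          (centralFactorial (p + 1) (j + 1 + 1 + 1) * u ^ (j + 1 + 1)) := by
      intro j _
      rw [show p + 2 + 1 = p + 1 + 2 from rfl, show j + 1 + 1 + 1 = j + 1 + 2 from rfl,
        centralFactorial_add_two]
      push_cast
      ring
    rw [Finset.sum_range_succ', Finset.sum_range_succ'] at h2 ⊢
    rw [Finset.sum_congr rfl h, Finset.sum_sub_distrib, ← Finset.mul_sum, ← Finset.mul_sum, h1,
      marsden_add_two, show p + 2 + 1 = p + 1 + 2 from rfl, centralFactorial_add_two_one,
      show 0 + 1 + 1 = 0 + 2 from rfl, centralFactorial_add_two,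
      centralFactorial_zero_right _ (by omega)]
    push_cast
    linear_combination -(((p : ℝ) + 1) / 2) ^ 2 * h2

open PowerSeries in
/-- The local functional maps the monomial of degree `p` to the Marsden polynomial. With `e ^ (u X)`
as generating function of the monomials, both sides are `p!` times the coefficient of `X ^ p` in
`(X / (2 sinh (X / 2))) ^ (p + 1) e ^ (u X)`. -/
theorem sum_coeff_mul_pow_eq_marsden (p : ℕ) (u : ℝ) :
    ∑ j ∈ Finset.Icc (-((p / 2 : ℕ) : ℤ)) ((p / 2 : ℕ) : ℤ), coeff p j * (u + (j : ℝ)) ^ p =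
      marsden p u := by
  have hR : diffQuotient * diffQuotient⁻¹ = 1 :=
    PowerSeries.mul_inv_cancel _ (by rw [constantCoeff_diffQuotient]; exact one_ne_zero)
  have hRp : diffQuotient ^ (p + 1) * diffQuotient⁻¹ ^ (p + 1) = 1 := by
    rw [← mul_pow, hR, one_pow]
  obtain ⟨Y, hY⟩ := X_pow_dvd_localSymbol_mul_sub_one p
  have h : localSymbol p * rescale u (exp ℝ) = diffQuotient⁻¹ ^ (p + 1) * rescale u (exp ℝ) +
      X ^ (p + 1) * (Y * diffQuotient⁻¹ ^ (p + 1) * rescale u (exp ℝ)) := by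
    linear_combination (diffQuotient⁻¹ ^ (p + 1) * rescale u (exp ℝ)) * hY -
      (localSymbol p * rescale u (exp ℝ)) * hRp
  rw [sum_coeff_mul_pow, h, map_add, coeff_X_pow_mul', if_neg (by omega), add_zero, mul_comm
    (diffQuotient⁻¹ ^ (p + 1)), coeff_mul, Finset.Nat.sum_antidiagonal_eq_sum_range_succ_mk,
    ← sum_centralFactorial_mul_pow p (p + 1) (by omega), Finset.mul_sum]
  refine Finset.sum_congr rfl fun j hj => ?_
  have hj' : j ≤ p := by simpa [Nat.lt_succ_iff] using hj
  have hc := centralFactorial_eq_coeff p j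
  rw [if_pos hj'] at hc
  have hf : (j.factorial : ℝ) ≠ 0 := by positivity
  rw [coeff_rescale_exp]
  field_simp
  linear_combination -u ^ j * hc

/-! ### B-splines and Marsden's identity -/

theorem bspline_nonneg (p : ℕ) (x : ℝ) : 0 ≤ bspline p x := by
  induction p generalizing x with
  | zero =>
    simp only [bspline]
    split_ifs <;> norm_num
  | succ p ih =>
    -- a factor of the recursion is negative only where the B-spline it multiplies vanishes
    have h1 : 0 ≤ (x + ((p : ℝ) + 2) / 2) * bspline p (x + 1 / 2) := by
      rcases le_or_gt 0 (x + ((p : ℝ) + 2) / 2) with h | h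
      · exact mul_nonneg h (ih _)
      · rw [bspline_eq_zero p _ (lt_of_lt_of_le (by linarith) (neg_le_abs (x + 1 / 2))), mul_zero]
    have h2 : 0 ≤ (((p : ℝ) + 2) / 2 - x) * bspline p (x - 1 / 2) := by
      rcases le_or_gt 0 (((p : ℝ) + 2) / 2 - x) with h | h
      · exact mul_nonneg h (ih _)
      · rw [bspline_eq_zero p _ (lt_of_lt_of_le (by linarith) (le_abs_self (x - 1 / 2))), mul_zero]
    simp only [bspline]
    positivity

theorem bspline_pos (p : ℕ) (x : ℝ) (h1 : -(((p : ℝ) + 1) / 2) < x) (h2 : x < ((p : ℝ) + 1) / 2) :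
    0 < bspline p x := by
  induction p generalizing x with
  | zero =>
    push_cast at h1 h2
    simp only [bspline]
    rw [if_pos ⟨by linarith, by linarith⟩]
    exact one_pos
  | succ p ih =>
    push_cast at h1 h2
    have hp : (0 : ℝ) ≤ p := p.cast_nonneg
    have e1 : 0 < x + ((p : ℝ) + 2) / 2 := by linarith
    have e2 : 0 < ((p : ℝ) + 2) / 2 - x := by linarith
    simp only [bspline]
    refine div_pos ?_ (by positivity)
    rcases lt_or_ge (x + 1 / 2) (((p : ℝ) + 1) / 2) with h | h
    · exact add_pos_of_pos_of_nonneg (mul_pos e1 (ih _ (by linarith) h))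
        (mul_nonneg e2.le (bspline_nonneg _ _))
    · refine add_pos_of_nonneg_of_pos (mul_nonneg e1.le (bspline_nonneg _ _)) (mul_pos e2 ?_)
      -- for `p = 0` the argument may be the left endpoint `-1/2`, where the B-spline equals `1`
      rcases Nat.eq_zero_or_pos p with rfl | hp1
      · push_cast at h h2
        simp only [bspline]
        rw [if_pos ⟨by linarith, by linarith⟩]
        exact one_pos
      · have hp1' : (1 : ℝ) ≤ p := by exact_mod_cast hp1
        exact ih _ (by linarith) (by linarith)

theorem mem_active_iff {p : ℕ} {h x : ℝ} {k : ℤ} :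
    k ∈ active p h x ↔ 0 < bspline p (x / h - k) := by
  simp [active]

theorem abs_sub_le_of_mem_active {p : ℕ} {h x : ℝ} {k : ℤ} (hk : k ∈ active p h x) :
    |x / h - k| ≤ ((p : ℝ) + 1) / 2 := by
  by_contra hc
  exact (mem_active_iff.mp hk).ne' (bspline_eq_zero p _ (not_le.mp hc))

theorem bspline_eq_zero_of_notMem_active {p : ℕ} {h x : ℝ} {k : ℤ} (hk : k ∉ active p h x) :
    bspline p (x / h - k) = 0 :=
  le_antisymm (not_lt.mp fun hc => hk (mem_active_iff.mpr hc)) (bspline_nonneg _ _)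

theorem summable_bspline_mul (p : ℕ) (y : ℝ) (g : ℤ → ℝ) :
    Summable fun k : ℤ => bspline p (y - k) * g k := by
  refine summable_of_hasFiniteSupport ((finite_active p 1 y).subset fun k hk => ?_)
  have h : bspline p (y - k) ≠ 0 := fun h0 => hk (by simp [h0])
  simpa using (bspline_nonneg p (y - k)).lt_of_ne' h

theorem marsden_succ (p : ℕ) (v : ℝ) :
    marsden (p + 1) v = (v + (p : ℝ) / 2) * marsden p (v - 1 / 2) := by
  rw [marsden, Finset.prod_range_succ', marsden, mul_comm]
  congr 1
  · push_cast
    ring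
  · refine Finset.prod_congr rfl fun i _ => ?_
    push_cast
    ring

theorem marsden_succ_sub_one (p : ℕ) (v : ℝ) :
    marsden (p + 1) (v - 1) = (v - (p : ℝ) / 2 - 1) * marsden p (v - 1 / 2) := by
  rw [marsden, Finset.prod_range_succ, marsden, mul_comm]
  congr 1
  · push_cast
    ring
  · refine Finset.prod_congr rfl fun i _ => ?_
    push_cast
    ring

/-- **Marsden's identity** for the cardinal B-spline. -/
theorem tsum_bspline_mul_marsden (p : ℕ) (y t : ℝ) :
    ∑' k : ℤ, bspline p (y - k) * marsden p (k - t) = (y - t) ^ p := by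
  induction p generalizing y t with
  | zero =>
    rw [tsum_eq_single ⌊y + 1 / 2⌋]
    · have h1 := Int.floor_le (y + 1 / 2)
      have h2 := Int.lt_floor_add_one (y + 1 / 2)
      simp only [bspline, marsden]
      rw [if_pos ⟨by linarith, by linarith⟩]
      simp
    · intro k hk
      simp only [bspline]
      rw [if_neg, zero_mul]
      rintro ⟨h1, h2⟩
      exact hk (Int.floor_eq_iff.mpr ⟨by linarith, by linarith⟩).symm
  | succ p ih =>
    have hp : (p : ℝ) + 1 ≠ 0 := by positivity
    let a : ℤ → ℝ := fun k =>
      (y - k + ((p : ℝ) + 2) / 2) / ((p : ℝ) + 1) * marsden (p + 1) (k - t)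
    let b : ℤ → ℝ := fun k =>
      (((p : ℝ) + 2) / 2 - y + k - 1) / ((p : ℝ) + 1) * marsden (p + 1) (k - t - 1)
    have hsplit : ∀ k : ℤ, bspline (p + 1) (y - k) * marsden (p + 1) (k - t) =
        bspline p (y + 1 / 2 - k) * a k +
          bspline p (y + 1 / 2 - ((k + 1 : ℤ) : ℝ)) * b (k + 1) := by
      intro k
      simp only [bspline, a, b]
      push_cast
      rw [show y - (k : ℝ) + 1 / 2 = y + 1 / 2 - k by ring,
        show y - (k : ℝ) - 1 / 2 = y + 1 / 2 - (k + 1) by ring,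
        show (k : ℝ) + 1 - t - 1 = k - t by ring]
      ring
    have hb := summable_bspline_mul p (y + 1 / 2) b
    -- the second half of the recursion is re-indexed by one node to meet the first
    have hshift : ∑' k : ℤ, bspline p (y + 1 / 2 - ((k + 1 : ℤ) : ℝ)) * b (k + 1) =
        ∑' k : ℤ, bspline p (y + 1 / 2 - k) * b k :=
      (Equiv.addRight (1 : ℤ)).tsum_eq fun k : ℤ => bspline p (y + 1 / 2 - k) * b k
    have hb' : Summable fun k : ℤ => bspline p (y + 1 / 2 - ((k + 1 : ℤ) : ℝ)) * b (k + 1) :=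
      (Equiv.addRight (1 : ℤ)).summable_iff.mpr hb
    rw [tsum_congr hsplit, (summable_bspline_mul p (y + 1 / 2) a).tsum_add hb', hshift,
      ← (summable_bspline_mul p (y + 1 / 2) a).tsum_add hb]
    have hterm : ∀ k : ℤ, bspline p (y + 1 / 2 - k) * a k + bspline p (y + 1 / 2 - k) * b k =
        (y - t) * (bspline p (y + 1 / 2 - k) * marsden p (k - (t + 1 / 2))) := by
      intro k
      simp only [a, b]
      rw [marsden_succ, marsden_succ_sub_one, show (k : ℝ) - t - 1 / 2 = k - (t + 1 / 2) by ring]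
      field_simp
      ring
    rw [tsum_congr hterm, tsum_mul_left, ih]
    ring

theorem sum_active_bspline_mul_marsden (p : ℕ) (h x t : ℝ) :
    ∑ k ∈ active p h x, bspline p (x / h - k) * marsden p (k - t) = (x / h - t) ^ p := by
  rw [← tsum_bspline_mul_marsden p (x / h) t]
  refine (tsum_eq_sum fun k hk => ?_).symm
  rw [bspline_eq_zero_of_notMem_active hk, zero_mul]

/-! ### Polynomial reproduction -/

/-- A discrete signed measure integrates the translates `v ↦ (v + t) ^ p` as the Dirac mass at `0`
does only if its moments up to order `p` are those of the Dirac mass. -/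
theorem sum_mul_pow_eq_zero_pow {ι : Type*} (S : Finset ι) (w v : ι → ℝ) (p : ℕ)
    (H : ∀ t : ℝ, ∑ i ∈ S, w i * (v i + t) ^ p = t ^ p) (r : ℕ) (hr : r ≤ p) :
    ∑ i ∈ S, w i * v i ^ r = 0 ^ r := by
  have hpoly : ∑ i ∈ S, Polynomial.C (w i) * (Polynomial.X + Polynomial.C (v i)) ^ p =
      (Polynomial.X : Polynomial ℝ) ^ p := by
    refine Polynomial.funext fun t => ?_
    rw [Polynomial.eval_finsetSum, Polynomial.eval_pow, Polynomial.eval_X, ← H t]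
    refine Finset.sum_congr rfl fun i _ => ?_
    simp [add_comm]
  have hc := congrArg (fun q => Polynomial.coeff q (p - r)) hpoly
  simp only [Polynomial.finsetSum_coeff, Polynomial.coeff_C_mul, Polynomial.coeff_X_add_C_pow,
    Polynomial.coeff_X_pow] at hc
  have hch : (p.choose (p - r) : ℝ) ≠ 0 := by
    exact_mod_cast (Nat.choose_pos (Nat.sub_le p r)).ne'
  refine mul_right_cancel₀ hch ?_
  rw [Finset.sum_mul, Finset.sum_congr rfl fun i _ => mul_assoc (w i) (v i ^ r) _]
  rw [show p - (p - r) = r by omega] at hc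
  rw [hc]
  rcases Nat.eq_zero_or_pos r with rfl | h
  · simp
  · rw [if_neg (by omega), zero_pow h.ne', zero_mul]

/-- The linear quasi-interpolant on the unit mesh is exact at `y = x / h` for `v ↦ (v - y) ^ r`,
`r ≤ p`. -/
theorem sum_active_moment (p : ℕ) (h x : ℝ) (r : ℕ) (hr : r ≤ p) :
    ∑ k ∈ active p h x, bspline p (x / h - k) *
      ∑ j ∈ Finset.Icc (-((p / 2 : ℕ) : ℤ)) ((p / 2 : ℕ) : ℤ),
        coeff p j * ((k : ℝ) + j - x / h) ^ r = 0 ^ r := by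
  have key := sum_mul_pow_eq_zero_pow
    (active p h x ×ˢ Finset.Icc (-((p / 2 : ℕ) : ℤ)) ((p / 2 : ℕ) : ℤ))
    (fun q => bspline p (x / h - q.1) * coeff p q.2) (fun q => (q.1 : ℝ) + q.2 - x / h) p ?_ r hr
  · rw [← key, Finset.sum_product]
    refine Finset.sum_congr rfl fun k _ => ?_
    rw [Finset.mul_sum]
    exact Finset.sum_congr rfl fun j _ => (mul_assoc _ _ _).symm
  · intro t
    rw [Finset.sum_product]
    have hM := sum_active_bspline_mul_marsden p h x (x / h - t)
    rw [sub_sub_cancel] at hM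
    rw [← hM]
    refine Finset.sum_congr rfl fun k _ => ?_
    rw [← sum_coeff_mul_pow_eq_marsden, Finset.mul_sum]
    refine Finset.sum_congr rfl fun j _ => ?_
    simp only
    rw [mul_assoc]
    congr 3
    ring

theorem sum_coeff (p : ℕ) :
    ∑ j ∈ Finset.Icc (-((p / 2 : ℕ) : ℤ)) ((p / 2 : ℕ) : ℤ), coeff p j = 1 := by
  have h := sum_coeff_mul p fun _ => 1
  simp only [mul_one] at h
  rw [h, Finset.sum_eq_single 0]
  · have hf : ((p + 1).factorial : ℝ) ≠ 0 := by positivity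
    simp [diffWeight, centralFactorial_self, hf]
  · intro l _ hl
    have h0 := Int.alternating_sum_range_choose_of_ne (n := 2 * l) (by omega)
    rw [show ∑ i ∈ Finset.range (2 * l + 1), (-1 : ℝ) ^ i * ((2 * l).choose i : ℝ) = 0 by
      exact_mod_cast h0, mul_zero]
  · simp

theorem sum_active_bspline (p : ℕ) (h x : ℝ) :
    ∑ k ∈ active p h x, bspline p (x / h - k) = 1 := by
  have h0 := sum_active_moment p h x 0 (Nat.zero_le p)
  simp only [pow_zero, mul_one] at h0
  rw [sum_coeff] at h0
  simpa using h0

/-! ### Taylor expansion on the stencils -/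

/-- Taylor's theorem at an interior point, with a two-sided remainder bound. -/
theorem exists_taylor_bound {f : ℝ → ℝ} {a b x : ℝ} (n : ℕ) (hx : x ∈ Set.Ioo a b)
    (hf : ContDiffOn ℝ ((n + 1 : ℕ) : WithTop ℕ∞) f (Set.Icc a b)) :
    ∃ c : ℕ → ℝ, c 0 = f x ∧ ∃ C : ℝ, 0 ≤ C ∧ ∀ᶠ s in 𝓝 x,
      |f s - ∑ r ∈ Finset.range (n + 1), c r * (s - x) ^ r| ≤ C * |s - x| ^ (n + 1) := by
  have hxI : x ∈ Set.Icc a b := Set.Ioo_subset_Icc_self hx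
  have hnhds : 𝓝[Set.Icc a b] x = 𝓝 x := nhdsWithin_eq_nhds.mpr (Icc_mem_nhds hx.1 hx.2)
  have ht := taylor_isLittleO (convex_Icc a b) hxI hf
  rw [hnhds] at ht
  let c : ℕ → ℝ := fun r => ((r.factorial : ℝ))⁻¹ * iteratedDerivWithin r f (Set.Icc a b) x
  refine ⟨c, by simp [c], 1 + |c (n + 1)|, by positivity, ?_⟩
  filter_upwards [ht.bound one_pos] with s hs
  rw [taylor_within_apply, Finset.sum_range_succ] at hs
  have he : ∑ r ∈ Finset.range (n + 1), ((r.factorial : ℝ)⁻¹ * (s - x) ^ r) •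
      iteratedDerivWithin r f (Set.Icc a b) x =
      ∑ r ∈ Finset.range (n + 1), c r * (s - x) ^ r := by
    refine Finset.sum_congr rfl fun r _ => ?_
    simp only [c, smul_eq_mul]
    ring
  have he' : (((n + 1).factorial : ℝ)⁻¹ * (s - x) ^ (n + 1)) •
      iteratedDerivWithin (n + 1) f (Set.Icc a b) x = c (n + 1) * (s - x) ^ (n + 1) := by
    simp only [c, smul_eq_mul]
    ring
  rw [he, he', Real.norm_eq_abs, Real.norm_eq_abs, abs_pow, one_mul] at hs
  calc |f s - ∑ r ∈ Finset.range (n + 1), c r * (s - x) ^ r|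
      = |(f s - (∑ r ∈ Finset.range (n + 1), c r * (s - x) ^ r +
          c (n + 1) * (s - x) ^ (n + 1))) + c (n + 1) * (s - x) ^ (n + 1)| := by
        congr 1
        ring
    _ ≤ |s - x| ^ (n + 1) + |c (n + 1)| * |s - x| ^ (n + 1) := by
        refine (abs_add_le _ _).trans (add_le_add hs ?_)
        rw [abs_mul, abs_pow]
    _ = (1 + |c (n + 1)|) * |s - x| ^ (n + 1) := by ring

theorem abs_node_sub_le {p : ℕ} {h x : ℝ} (hh : 0 < h) {k j : ℤ} (hk : k ∈ active p h x)
    (hj : j ∈ Finset.Icc (-((p / 2 : ℕ) : ℤ)) ((p / 2 : ℕ) : ℤ)) :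
    |((k : ℝ) + j) * h - x| ≤ ((p : ℝ) + 1) * h := by
  have h1 := abs_sub_le_of_mem_active hk
  obtain ⟨hj1, hj2⟩ := Finset.mem_Icc.mp hj
  have hp : ((p / 2 : ℕ) : ℝ) ≤ (p : ℝ) / 2 := Nat.cast_div_le
  have hj1' : -((p / 2 : ℕ) : ℝ) ≤ j := by
    rw [← Int.cast_natCast (R := ℝ), ← Int.cast_neg]
    exact Int.cast_le.mpr hj1
  have hj2' : (j : ℝ) ≤ ((p / 2 : ℕ) : ℝ) := by
    rw [← Int.cast_natCast (R := ℝ)]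
    exact Int.cast_le.mpr hj2
  have h2 : |(k : ℝ) + j - x / h| ≤ (p : ℝ) + 1 := by
    rw [abs_le] at h1 ⊢
    constructor <;> linarith
  have h3 : ((k : ℝ) + j) * h - x = ((k : ℝ) + j - x / h) * h := by field_simp
  rw [h3, abs_mul, abs_of_pos hh]
  exact mul_le_mul_of_nonneg_right h2 hh.le

theorem eq_zero_of_mem_active_one_zero {h : ℝ} {k : ℤ} (hk : k ∈ active 1 h 0) : k = 0 := by
  have h1 := abs_sub_le_of_mem_active hk
  rw [zero_div, zero_sub, abs_neg] at h1
  push_cast at h1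
  norm_num at h1
  have h2 : |k| ≤ 1 := by exact_mod_cast h1
  obtain ⟨h3, h4⟩ := abs_le.mp h2
  have h5 := mem_active_iff.mp hk
  interval_cases k
  · norm_num [bspline] at h5
  · rfl
  · norm_num [bspline] at h5

/-- `f` is of class `C^{p+1}` near `x`, because `x` is interior to one stencil, or for `p = 1` to
the interval spanned by the active nodes, for some admissible `h`. The case `p = 1`, `x = 0` is
excluded: there `0` is the only active node for every `h`. -/
theorem exists_contDiffOn_Icc (p : ℕ) (hp : 1 ≤ p) (f : ℝ → ℝ) (x : ℝ) (hx : p = 1 → x ≠ 0)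
    (hf : ∀ᶠ h in 𝓝[>] (0 : ℝ), ∀ k ∈ active p h x,
      ContDiffOn ℝ ((p + 1 : ℕ) : WithTop ℕ∞) f
        (Set.Icc (h * ((k : ℝ) - ((p / 2 : ℕ) : ℝ))) (h * ((k : ℝ) + ((p / 2 : ℕ) : ℝ)))))
    (hf_one : p = 1 → ∀ᶠ h in 𝓝[>] (0 : ℝ), ∀ k ∈ active p h x, ∀ l ∈ active p h x,
        ContDiffOn ℝ 2 f (Set.Icc (h * (k : ℝ)) (h * (l : ℝ)))) :
    ∃ a b : ℝ, x ∈ Set.Ioo a b ∧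
      ContDiffOn ℝ ((p + 1 : ℕ) : WithTop ℕ∞) f (Set.Icc a b) := by
  rcases hp.eq_or_lt with rfl | hp2
  · have hx0 : 0 < |x| := abs_pos.mpr (hx rfl)
    -- along `h = |x| / (n + 1/2)` the point `x / h` lies midway between two nodes
    have hlim : Tendsto (fun n : ℕ => |x| / ((n : ℝ) + 1 / 2)) atTop (𝓝[>] (0 : ℝ)) := by
      refine tendsto_nhdsWithin_iff.mpr ⟨?_, Eventually.of_forall fun n => ?_⟩
      · exact (tendsto_natCast_atTop_atTop.atTop_add tendsto_const_nhds).const_div_atTop _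
      · exact div_pos hx0 (by positivity)
    obtain ⟨n, hn, hpos⟩ := ((hlim.eventually (hf_one rfl)).and
      (hlim.eventually self_mem_nhdsWithin)).exists
    set h : ℝ := |x| / ((n : ℝ) + 1 / 2) with hh
    have hpos' : 0 < h := hpos
    obtain ⟨k, hk⟩ : ∃ k : ℤ, x / h = (k : ℝ) + 1 / 2 := by
      have hn0 : (n : ℝ) + 1 / 2 ≠ 0 := by positivity
      have hxh : |x| / h = (n : ℝ) + 1 / 2 := by
        rw [hh]
        field_simp
      rcases abs_cases x with ⟨he, _⟩ | ⟨he, _⟩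
      · exact ⟨n, by rw [he] at hxh; exact_mod_cast hxh⟩
      · refine ⟨-n - 1, ?_⟩
        rw [he, neg_div] at hxh
        push_cast
        linarith
    have hk1 : k ∈ active 1 h x := by
      rw [mem_active_iff, hk]
      refine bspline_pos 1 _ ?_ ?_ <;> push_cast <;> linarith
    have hk2 : k + 1 ∈ active 1 h x := by
      rw [mem_active_iff, hk]
      refine bspline_pos 1 _ ?_ ?_ <;> push_cast <;> linarith
    have hxk : x = h * ((k : ℝ) + 1 / 2) := by
      rw [← hk]
      field_simp
    refine ⟨_, _, ⟨?_, ?_⟩, hn k hk1 (k + 1) hk2⟩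
    · rw [hxk]
      exact mul_lt_mul_of_pos_left (by linarith) hpos'
    · conv_lhs => rw [hxk]
      push_cast
      exact mul_lt_mul_of_pos_left (by linarith) hpos'
  · obtain ⟨h, hh, hpos⟩ := (hf.and self_mem_nhdsWithin).exists
    have hpos' : 0 < h := hpos
    have hp2' : (2 : ℝ) ≤ p := by exact_mod_cast hp2
    have hm : (1 : ℝ) ≤ ((p / 2 : ℕ) : ℝ) := by exact_mod_cast (by omega : 1 ≤ p / 2)
    have hr := abs_le.mp (abs_sub_round (x / h))
    have hk : round (x / h) ∈ active p h x := by
      rw [mem_active_iff]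
      exact bspline_pos p _ (by linarith [hr.1]) (by linarith [hr.2])
    have hxh : x = h * (x / h) := by field_simp
    refine ⟨_, _, ⟨?_, ?_⟩, hh _ hk⟩
    · conv_rhs => rw [hxh]
      exact mul_lt_mul_of_pos_left (by linarith [hr.1]) hpos'
    · conv_lhs => rw [hxh]
      exact mul_lt_mul_of_pos_left (by linarith [hr.2]) hpos'

/-- On the active stencils `f` is approximated to order `h ^ (p + 1)` by a fixed polynomial of
degree at most `p` with value `f x` at `x`. For `p = 1`, `x = 0` no smoothness of `f` is available, but the
only node is `x` itself and a constant polynomial is exact. -/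
theorem exists_taylor_bound_stencil (p : ℕ) (hp : 1 ≤ p) (f : ℝ → ℝ) (x : ℝ)
    (hf : ∀ᶠ h in 𝓝[>] (0 : ℝ), ∀ k ∈ active p h x,
      ContDiffOn ℝ ((p + 1 : ℕ) : WithTop ℕ∞) f
        (Set.Icc (h * ((k : ℝ) - ((p / 2 : ℕ) : ℝ))) (h * ((k : ℝ) + ((p / 2 : ℕ) : ℝ)))))
    (hf_one : p = 1 → ∀ᶠ h in 𝓝[>] (0 : ℝ), ∀ k ∈ active p h x, ∀ l ∈ active p h x,
        ContDiffOn ℝ 2 f (Set.Icc (h * (k : ℝ)) (h * (l : ℝ)))) :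
    ∃ c : ℕ → ℝ, c 0 = f x ∧ ∃ C : ℝ, 0 ≤ C ∧ ∀ᶠ h in 𝓝[>] (0 : ℝ), ∀ k ∈ active p h x,
      ∀ j ∈ Finset.Icc (-((p / 2 : ℕ) : ℤ)) ((p / 2 : ℕ) : ℤ),
        |f (((k : ℝ) + j) * h) -
          ∑ r ∈ Finset.range (p + 1), c r * (((k : ℝ) + j) * h - x) ^ r| ≤ C * h ^ (p + 1) := by
  by_cases hx : p = 1 ∧ x = 0
  · obtain ⟨rfl, rfl⟩ := hx
    refine ⟨fun r => if r = 0 then f 0 else 0, by simp, 0, le_rfl,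
      Eventually.of_forall fun h k hk j hj => ?_⟩
    have hj0 : j = 0 := by simpa using hj
    simp [eq_zero_of_mem_active_one_zero hk, hj0]
  · obtain ⟨a, b, hab, hfab⟩ :=
      exists_contDiffOn_Icc p hp f x (fun h1 h2 => hx ⟨h1, h2⟩) hf hf_one
    obtain ⟨c, hc0, C, hC, hb⟩ := exists_taylor_bound p hab hfab
    refine ⟨c, hc0, C * ((p : ℝ) + 1) ^ (p + 1), by positivity, ?_⟩
    obtain ⟨δ, hδ, hball⟩ := Metric.eventually_nhds_iff.mp hb
    have hsmall : Set.Ioo (0 : ℝ) (δ / ((p : ℝ) + 1)) ∈ 𝓝[>] (0 : ℝ) :=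
      Ioo_mem_nhdsGT (by positivity)
    filter_upwards [hsmall] with h hh k hk j hj
    have hn := abs_node_sub_le hh.1 hk hj
    have hlt : ((p : ℝ) + 1) * h < δ := by
      have := (lt_div_iff₀ (by positivity : (0 : ℝ) < (p : ℝ) + 1)).mp hh.2
      linarith
    refine (hball (by rw [Real.dist_eq]; exact hn.trans_lt hlt)).trans ?_
    rw [mul_assoc, ← mul_pow]
    exact mul_le_mul_of_nonneg_left (pow_le_pow_left₀ (abs_nonneg _) hn _) hC

/-! ### The error of the quasi-interpolants -/

/-- On the Taylor polynomial, the linear quasi-interpolant is exact. -/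
theorem sum_active_taylor (p : ℕ) (x h : ℝ) (hh : 0 < h) (c : ℕ → ℝ) :
    ∑ k ∈ active p h x, bspline p (x / h - k) *
      ∑ j ∈ Finset.Icc (-((p / 2 : ℕ) : ℤ)) ((p / 2 : ℕ) : ℤ), coeff p j *
        ∑ r ∈ Finset.range (p + 1), c r * (((k : ℝ) + j) * h - x) ^ r = c 0 := by
  have h1 : ∀ k ∈ active p h x, bspline p (x / h - k) *
      ∑ j ∈ Finset.Icc (-((p / 2 : ℕ) : ℤ)) ((p / 2 : ℕ) : ℤ), coeff p j *
        ∑ r ∈ Finset.range (p + 1), c r * (((k : ℝ) + j) * h - x) ^ r =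
      ∑ r ∈ Finset.range (p + 1), c r * h ^ r * (bspline p (x / h - k) *
        ∑ j ∈ Finset.Icc (-((p / 2 : ℕ) : ℤ)) ((p / 2 : ℕ) : ℤ),
          coeff p j * ((k : ℝ) + j - x / h) ^ r) := by
    intro k _
    simp only [Finset.mul_sum]
    rw [Finset.sum_comm]
    refine Finset.sum_congr rfl fun r _ => Finset.sum_congr rfl fun j _ => ?_
    rw [show ((k : ℝ) + j) * h - x = h * ((k : ℝ) + j - x / h) by field_simp, mul_pow]
    ring
  rw [Finset.sum_congr rfl h1, Finset.sum_comm, Finset.sum_eq_single 0]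
  · rw [← Finset.mul_sum, sum_active_moment p h x 0 (Nat.zero_le p)]
    simp
  · intro r hr hr0
    rw [← Finset.mul_sum, sum_active_moment p h x r (by simpa [Nat.lt_succ_iff] using hr),
      zero_pow hr0, mul_zero]
  · simp

/-- Perturbing convex weights `B` by relative factors `ψ` that agree up to `O(ε)` and normalizing
again changes a weighted mean by `O(ε)`. -/
theorem abs_weighted_mean_sub_le {ι : Type*} (S : Finset ι) (B ψ L : ι → ℝ) (K : ι → ι → ℝ)
    (M ε E Λ F : ℝ) (hB : ∀ k ∈ S, 0 ≤ B k) (hB1 : ∑ k ∈ S, B k = 1)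
    (hε : 0 ≤ ε) (hK : ∀ k ∈ S, ∀ l ∈ S, |K k l| ≤ M)
    (hψ : ∀ k ∈ S, ∀ l ∈ S, ψ k = ψ l * (1 + K k l * ε))
    (hne : ∑ k ∈ S, B k * ψ k ≠ 0) (hL : ∀ k ∈ S, |L k| ≤ Λ) (hMε : M * ε ≤ 1 / 2)
    (hlin : |∑ k ∈ S, B k * L k - F| ≤ E) :
    |∑ k ∈ S, B k * ψ k / (∑ j ∈ S, B j * ψ j) * L k - F| ≤
      2 * (E + M * (Λ + |F|) * ε) := by
  obtain ⟨l, hl⟩ : S.Nonempty := by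
    rw [Finset.nonempty_iff_ne_empty]
    rintro rfl
    simp at hB1
  have hM : 0 ≤ M := (abs_nonneg _).trans (hK l hl l hl)
  set κ : ℝ := ∑ k ∈ S, B k * K k l with hκ
  set ν : ℝ := ∑ k ∈ S, B k * L k * K k l with hν
  have hsum : ∑ k ∈ S, B k * ψ k = ψ l * (1 + κ * ε) := by
    rw [hκ, ← hB1, Finset.sum_mul, ← Finset.sum_add_distrib, Finset.mul_sum]
    refine Finset.sum_congr rfl fun k hk => ?_
    rw [hψ k hk l hl]
    ring
  have hψl : ψ l ≠ 0 := by
    intro h0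
    rw [hsum, h0, zero_mul] at hne
    exact hne rfl
  have hκM : |κ| ≤ M := by
    calc |κ| ≤ ∑ k ∈ S, |B k * K k l| := Finset.abs_sum_le_sum_abs _ _
      _ ≤ ∑ k ∈ S, B k * M := Finset.sum_le_sum fun k hk => by
          rw [abs_mul, abs_of_nonneg (hB k hk)]
          exact mul_le_mul_of_nonneg_left (hK k hk l hl) (hB k hk)
      _ = M := by rw [← Finset.sum_mul, hB1, one_mul]
  have hνM : |ν| ≤ Λ * M := by
    calc |ν| ≤ ∑ k ∈ S, |B k * L k * K k l| := Finset.abs_sum_le_sum_abs _ _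
      _ ≤ ∑ k ∈ S, B k * (Λ * M) := Finset.sum_le_sum fun k hk => by
          rw [abs_mul, abs_mul, abs_of_nonneg (hB k hk), mul_assoc]
          exact mul_le_mul_of_nonneg_left (mul_le_mul (hL k hk) (hK k hk l hl) (abs_nonneg _)
            ((abs_nonneg _).trans (hL k hk))) (hB k hk)
      _ = Λ * M := by rw [← Finset.sum_mul, hB1, one_mul]
  have hden : 1 / 2 ≤ 1 + κ * ε := by
    have h1 : |κ * ε| ≤ M * ε := by
      rw [abs_mul, abs_of_nonneg hε]
      exact mul_le_mul_of_nonneg_right hκM hε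
    linarith [(abs_le.mp h1).1]
  have hden0 : (0 : ℝ) < 1 + κ * ε := by linarith
  have hrep : ∑ k ∈ S, B k * ψ k / (∑ j ∈ S, B j * ψ j) * L k - F =
      ((∑ k ∈ S, B k * L k - F) + (ν - κ * F) * ε) / (1 + κ * ε) := by
    have h1 : ∑ k ∈ S, B k * ψ k / (∑ j ∈ S, B j * ψ j) * L k =
        (∑ k ∈ S, B k * L k + ν * ε) / (1 + κ * ε) := by
      rw [hν, Finset.sum_mul, ← Finset.sum_add_distrib, Finset.sum_div]
      refine Finset.sum_congr rfl fun k hk => ?_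
      rw [hsum, hψ k hk l hl]
      field_simp
    rw [h1, eq_div_iff hden0.ne', sub_mul, div_mul_cancel₀ _ hden0.ne']
    ring
  rw [hrep, abs_div, abs_of_pos hden0, div_le_iff₀ hden0]
  have h1 : |ν - κ * F| ≤ M * (Λ + |F|) := by
    calc |ν - κ * F| ≤ |ν| + |κ * F| := abs_sub _ _
      _ ≤ Λ * M + M * |F| := by
          rw [abs_mul]
          exact add_le_add hνM (mul_le_mul_of_nonneg_right hκM (abs_nonneg _))
      _ = M * (Λ + |F|) := by ring
  have h2 : |(∑ k ∈ S, B k * L k - F) + (ν - κ * F) * ε| ≤ E + M * (Λ + |F|) * ε := by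
    refine (abs_add_le _ _).trans (add_le_add hlin ?_)
    rw [abs_mul, abs_of_nonneg hε]
    exact mul_le_mul_of_nonneg_right h1 hε
  have h3 : 0 ≤ E + M * (Λ + |F|) * ε := (abs_nonneg _).trans h2
  nlinarith [mul_nonneg h3 (sub_nonneg.mpr hden)]

end WenoBSpline

end

theorem mainTheorem1 (p : ℕ) (hp : 1 ≤ p) (f : ℝ → ℝ) (x : ℝ)
    -- the weight function, which may depend on the mesh size `h`
    (Ψ : ℝ → ℝ → ℝ)
    -- the numbers `K_{k,l}`, bounded independently of `h`
    (K : ℝ → ℤ → ℤ → ℝ) (M : ℝ)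
    (hK : ∀ᶠ h in 𝓝[>] (0 : ℝ), ∀ k ∈ WenoBSpline.active p h x,
      ∀ l ∈ WenoBSpline.active p h x, |K h k l| ≤ M)
    (hΨ : ∀ᶠ h in 𝓝[>] (0 : ℝ), ∀ k ∈ WenoBSpline.active p h x,
      ∀ l ∈ WenoBSpline.active p h x,
        Ψ h (WenoBSpline.smoothnessIndicator p h f k) =
          Ψ h (WenoBSpline.smoothnessIndicator p h f l) * (1 + K h k l * h ^ (p + 1)))
    -- the non-linear weights are well defined
    (hne : ∀ᶠ h in 𝓝[>] (0 : ℝ),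
      ∑ j ∈ WenoBSpline.active p h x, WenoBSpline.alpha p h f (Ψ h) x j ≠ 0)
    -- `f` is `C^{p+1}` on every stencil
    (hf : ∀ᶠ h in 𝓝[>] (0 : ℝ), ∀ k ∈ WenoBSpline.active p h x,
      ContDiffOn ℝ ((p + 1 : ℕ) : WithTop ℕ∞) f
        (Set.Icc (h * ((k : ℝ) - ((p / 2 : ℕ) : ℝ))) (h * ((k : ℝ) + ((p / 2 : ℕ) : ℝ)))))
    -- for `p = 1` the stencils are single points: `f` is `C^2` on the interval they span
    (hf_one : p = 1 → ∀ᶠ h in 𝓝[>] (0 : ℝ), ∀ k ∈ WenoBSpline.active p h x,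
      ∀ l ∈ WenoBSpline.active p h x,
        ContDiffOn ℝ 2 f (Set.Icc (h * (k : ℝ)) (h * (l : ℝ)))) :
    (fun h : ℝ => |WenoBSpline.quasiInterpolantNL p h f (Ψ h) x - f x|)
      =O[𝓝[>] (0 : ℝ)] (fun h : ℝ => h ^ (p + 1)) := by
  open WenoBSpline in
  obtain ⟨c, hc0, C, hC, hT⟩ := exists_taylor_bound_stencil p hp f x hf hf_one
  set J : Finset ℤ := Finset.Icc (-((p / 2 : ℕ) : ℤ)) ((p / 2 : ℕ) : ℤ) with hJ
  set A : ℝ := ∑ j ∈ J, |coeff p j| with hA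
  have hA0 : 0 ≤ A := Finset.sum_nonneg fun j _ => abs_nonneg _
  -- `N` bounds the values of `f` at the active nodes for `h ≤ 1`
  set N : ℝ := C + ∑ r ∈ Finset.range (p + 1), |c r| * ((p : ℝ) + 1) ^ r with hN
  refine Asymptotics.IsBigO.of_bound (2 * (A * C + M * (A * N + |f x|))) ?_
  have hsmall : ∀ᶠ h in 𝓝[>] (0 : ℝ), M * h ^ (p + 1) ≤ 1 / 2 := by
    have hlim : Tendsto (fun h : ℝ => M * h ^ (p + 1)) (𝓝[>] 0) (𝓝 0) := by
      have hcont : Continuous fun h : ℝ => M * h ^ (p + 1) := by fun_prop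
      simpa using (hcont.tendsto 0).mono_left nhdsWithin_le_nhds
    exact hlim.eventually_le_const (by norm_num)
  filter_upwards [hK, hΨ, hne, hT, hsmall, Ioo_mem_nhdsGT (one_pos : (0 : ℝ) < 1)] with
    h hKh hΨh hneh hTh hMh hh
  have hpow1 : h ^ (p + 1) ≤ 1 := pow_le_one₀ hh.1.le hh.2.le
  have hpow0 : 0 ≤ h ^ (p + 1) := pow_nonneg hh.1.le _
  have hlocal : ∀ (g : ℤ → ℝ) (b : ℝ), (∀ j ∈ J, |g j| ≤ b) →
      |∑ j ∈ J, coeff p j * g j| ≤ A * b := by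
    intro g b hg
    rw [hA, Finset.sum_mul]
    refine (Finset.abs_sum_le_sum_abs _ _).trans (Finset.sum_le_sum fun j hj => ?_)
    rw [abs_mul]
    exact mul_le_mul_of_nonneg_left (hg j hj) (abs_nonneg _)
  have hfN : ∀ k ∈ active p h x, ∀ j ∈ J, |f (((k : ℝ) + j) * h)| ≤ N := by
    intro k hk j hj
    have h1 := hTh k hk j hj
    have h2 : |∑ r ∈ Finset.range (p + 1), c r * (((k : ℝ) + j) * h - x) ^ r| ≤
        ∑ r ∈ Finset.range (p + 1), |c r| * ((p : ℝ) + 1) ^ r := by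
      refine (Finset.abs_sum_le_sum_abs _ _).trans (Finset.sum_le_sum fun r _ => ?_)
      rw [abs_mul, abs_pow]
      refine mul_le_mul_of_nonneg_left (pow_le_pow_left₀ (abs_nonneg _) ?_ _) (abs_nonneg _)
      exact (abs_node_sub_le hh.1 hk hj).trans
        (mul_le_of_le_one_right (by positivity) hh.2.le)
    have h3 : C * h ^ (p + 1) ≤ C := mul_le_of_le_one_right hC hpow1
    have h4 := abs_sub_abs_le_abs_sub (f (((k : ℝ) + j) * h))
      (∑ r ∈ Finset.range (p + 1), c r * (((k : ℝ) + j) * h - x) ^ r)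
    linarith
  have hlin : |∑ k ∈ active p h x, bspline p (x / h - k) * localFunctional p h f k - f x| ≤
      A * C * h ^ (p + 1) := by
    rw [← hc0, ← sum_active_taylor p x h hh.1 c, ← Finset.sum_sub_distrib]
    calc _ ≤ ∑ k ∈ active p h x, bspline p (x / h - k) * (A * (C * h ^ (p + 1))) := by
          refine (Finset.abs_sum_le_sum_abs _ _).trans (Finset.sum_le_sum fun k hk => ?_)
          rw [← mul_sub, abs_mul, abs_of_nonneg (bspline_nonneg _ _), localFunctional,
            ← Finset.sum_sub_distrib]
          refine mul_le_mul_of_nonneg_left ?_ (bspline_nonneg _ _)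
          rw [Finset.sum_congr rfl fun j _ => (mul_sub _ _ _).symm]
          exact hlocal _ _ (hTh k hk)
      _ = A * C * h ^ (p + 1) := by
          rw [← Finset.sum_mul, sum_active_bspline, one_mul, mul_assoc]
  have key := abs_weighted_mean_sub_le (active p h x) (fun k => bspline p (x / h - k))
    (fun k => Ψ h (smoothnessIndicator p h f k)) (localFunctional p h f) (K h) M (h ^ (p + 1))
    (A * C * h ^ (p + 1)) (A * N) (f x) (fun k _ => bspline_nonneg _ _)
    (sum_active_bspline p h x) hpow0 hKh hΨh hneh
    (fun k hk => hlocal _ _ (hfN k hk)) hMh hlin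
  rw [Real.norm_eq_abs, abs_abs, Real.norm_eq_abs, abs_of_nonneg hpow0]
  refine key.trans (le_of_eq ?_)
  ring
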